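/- Let $(M,g)$ be a complete smooth Riemannian manifold of dimension $N$ (without boundary), with volume measure $dv_g$ and gradient $\nabla$, let $\Omega\subset M$ be open, let $p>1$ and $\alpha\in\mathbb{R}$. For open $U\subset M$, the space $W^{1,p}(U)$ is the completion of $\{\varphi\in C^\infty(U):\int_U|\varphi|^p\,dv_g+\int_U|\nabla\varphi|^p\,dv_g<\infty\}$ with respect to the norm $\big(\int_U|\varphi|^p\,dv_g+\int_U|\nabla\varphi|^p\,dv_g\big)^{1/p}$, and $\rho\in W^{1,p}_{loc}(\Omega)$ means $\rho\in W^{1,p}(U)$ for every open $U$ whose closure is compact and contained in $\Omega$. Let $\rho\in W^{1,p}_{loc}(\Omega)$ be nonnegative (almost everywhere) on $\Omega$ and such that i) $-(p-1-\alpha)\Delta_p\rho\ge 0$ on $\Omega$ in the weak sense, that is, $$(p-1-\alpha)\int_\Omega|\nabla\rho|^{p-2}\,\nabla\rho\cdot\nabla\varphi\,dv_g\ \ge\ 0\qquad\text{for every } \varphi\in C^1_0(\Omega),\ \varphi\ge 0;$$ ii) $\dfrac{|\nabla\rho|^p}{\rho^{p-\alpha}}\in L^1_{loc}(\Omega)$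 and $\rho^\alpha\in L^1_{loc}(\Omega)$. Then $$\left(\frac{|p-1-\alpha|}{p}\right)^{p}\int_\Omega\rho^\alpha\,\frac{|u|^p}{\rho^p}\,|\nabla\rho|^p\,dv_g\ \le\ \int_\Omega\rho^\alpha\,|\nabla u|^p\,dv_g\qquad\text{for every } u\in C_0^\infty(\Omega).$$ Here powers and quotients take values in $[0,\infty]$: $\rho^\alpha=\infty$ where $\rho=0$ and $\alpha<0$, and an integrand containing the factor $|\nabla\rho|^p$ is $0$ where $\rho=0$ and $\nabla\rho=0$ (which is almost everywhere on $\{\rho=0\}$). -/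

import Mathlib

open Bundle MeasureTheory Set Filter Manifold
open scoped ENNReal ContDiff Topology

noncomputable section

namespace RiemannianHardy

section Gradient

variable {N : ℕ} {M : Type*} [TopologicalSpace M] [ChartedSpace (EuclideanSpace ℝ (Fin N)) M]
  [RiemannianBundle (fun x : M ↦ TangentSpace (𝓡 N) x)]

/-- Tangent spaces are finite-dimensional, hence complete for the Riemannian norm. -/
theorem completeSpace_tangentSpace (x : M) : CompleteSpace (TangentSpace (𝓡 N) x) :=
  haveI : FiniteDimensional ℝ (TangentSpace (𝓡 N) x) :=
    inferInstanceAs (FiniteDimensional ℝ (EuclideanSpace ℝ (Fin N)))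
  FiniteDimensional.complete ℝ (TangentSpace (𝓡 N) x)

/-- The Riemannian gradient `∇ f x`: the tangent vector that represents the differential
`df x` with respect to the inner product of the tangent space. -/
def grad (f : M → ℝ) (x : M) : TangentSpace (𝓡 N) x :=
  haveI := completeSpace_tangentSpace (N := N) x
  (InnerProductSpace.toDual ℝ (TangentSpace (𝓡 N) x)).symm (mfderiv (𝓡 N) 𝓘(ℝ, ℝ) f x)

end Gradient

section Volume

variable (N : ℕ) {M : Type*} [TopologicalSpace M] [ChartedSpace (EuclideanSpace ℝ (Fin N)) M]
  [RiemannianBundle (fun x : M ↦ TangentSpace (𝓡 N) x)]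

/-- The matrix `g_ij` of the Riemannian metric in the preferred chart at `x`, as a function of
the coordinates `z`: the inner products of the coordinate vector fields `∂_i`, `∂_j`. -/
def metricMatrix (x : M) (z : EuclideanSpace ℝ (Fin N)) : Matrix (Fin N) (Fin N) ℝ :=
  Matrix.of fun i j ↦
    inner ℝ
      (mfderiv (𝓡 N) (𝓡 N) (extChartAt (𝓡 N) x).symm z (EuclideanSpace.single i (1 : ℝ)))
      (mfderiv (𝓡 N) (𝓡 N) (extChartAt (𝓡 N) x).symm z (EuclideanSpace.single j (1 : ℝ)))

variable [MeasurableSpace M]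

/-- The measure `√(det g_ij) dz` of the preferred chart at `x`, transported to the domain of
this chart. -/
def chartVolume (x : M) : Measure M :=
  ((volume.restrict (extChartAt (𝓡 N) x).target).withDensity
    (fun z ↦ ENNReal.ofReal √(metricMatrix N x z).det)).map (extChartAt (𝓡 N) x).symm

variable (M) in
/-- The Riemannian volume measure `dv_g`. The measures `√(det g_ij) dz` of the charts agree on
the overlaps, and the measure which they define together is their supremum. -/
def riemannianVolume : Measure M := ⨆ x : M, chartVolume N x

end Volume

section FunctionSpaces

variable {N : ℕ} {M : Type*} [TopologicalSpace M] [ChartedSpace (EuclideanSpace ℝ (Fin N)) M]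
  [RiemannianBundle (fun x : M ↦ TangentSpace (𝓡 N) x)] [MeasurableSpace M]

/-- `f ∈ W^{1,p}(U)` with gradient `G`. Here `W^{1,p}(U)` is the completion of the space of
smooth functions on `U` with `∫_U |φ|^p + ∫_U |∇φ|^p < ∞` under the norm
`(∫_U |φ|^p + ∫_U |∇φ|^p)^{1/p}`, so that `f` and `G` are the limits in `L^p(U)` of `φ n` and of
`∇ (φ n)`. The vector field `G` is then a.e. measurable, as an a.e. limit of smooth ones. -/
structure HasSobolevGrad (p : ℝ) (U : Set M) (f : M → ℝ)
    (G : (x : M) → TangentSpace (𝓡 N) x) : Prop where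
  exists_approx : ∃ φ : ℕ → M → ℝ,
    (∀ n, ContMDiffOn (𝓡 N) 𝓘(ℝ, ℝ) ∞ (φ n) U) ∧
    (∀ n, MemLp (φ n) (ENNReal.ofReal p) ((riemannianVolume N M).restrict U)) ∧
    (∀ n, MemLp (fun x ↦ ‖grad (N := N) (φ n) x‖) (ENNReal.ofReal p)
      ((riemannianVolume N M).restrict U)) ∧
    (∀ n, MemLp (fun x ↦ φ n x - f x) (ENNReal.ofReal p)
      ((riemannianVolume N M).restrict U)) ∧
    (∀ n, MemLp (fun x ↦ ‖grad (N := N) (φ n) x - G x‖) (ENNReal.ofReal p)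
      ((riemannianVolume N M).restrict U)) ∧
    Tendsto (fun n ↦ eLpNorm (fun x ↦ φ n x - f x) (ENNReal.ofReal p)
      ((riemannianVolume N M).restrict U)) atTop (𝓝 0) ∧
    Tendsto (fun n ↦ eLpNorm (fun x ↦ ‖grad (N := N) (φ n) x - G x‖) (ENNReal.ofReal p)
      ((riemannianVolume N M).restrict U)) atTop (𝓝 0)

/-- `f ∈ W^{1,p}_loc(Ω)` with gradient `G`: on every open `U` whose closure is compact and
contained in `Ω`, the function `f` is in `W^{1,p}(U)` with gradient `G`. -/
def HasLocSobolevGrad (p : ℝ) (Ω : Set M) (f : M → ℝ)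
    (G : (x : M) → TangentSpace (𝓡 N) x) : Prop :=
  ∀ U : Set M, IsOpen U → IsCompact (closure U) → closure U ⊆ Ω → HasSobolevGrad p U f G

/-- `- c Δ_p ρ ≥ 0` on `Ω` in the weak sense, where `G = ∇ρ`: for every nonnegative
`φ ∈ C^1_0(Ω)`, `c ∫_Ω |∇ρ|^{p-2} ∇ρ ⬝ ∇φ dv_g ≥ 0`. -/
def WeakNegPLaplacianNonneg (c p : ℝ) (Ω : Set M) (G : (x : M) → TangentSpace (𝓡 N) x) : Prop :=
  ∀ φ : M → ℝ, ContMDiff (𝓡 N) 𝓘(ℝ, ℝ) 1 φ → HasCompactSupport φ → tsupport φ ⊆ Ω →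
    (∀ x, 0 ≤ φ x) →
    0 ≤ c * ∫ x in Ω, ‖G x‖ ^ (p - 2) * inner ℝ (G x) (grad (N := N) φ x) ∂(riemannianVolume N M)

variable (N) in
/-- The nonnegative function `f`, with values in `[0, ∞]`, is in `L^1_loc(Ω)`. -/
def LocL1 (Ω : Set M) (f : M → ℝ≥0∞) : Prop :=
  ∀ K : Set M, IsCompact K → K ⊆ Ω →
    AEMeasurable f ((riemannianVolume N M).restrict K) ∧
      ∫⁻ x in K, f x ∂(riemannianVolume N M) < ⊤

end FunctionSpaces

end RiemannianHardy

end

/-! Write c = p - 1 - α. The inequality comes from testing the weak inequality with |u|^p ρ^(-c).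
The gradient of this function is p |u|^(p-2) u ρ^(-c) ∇u - c |u|^p ρ^(α-p) ∇ρ, so that, with A = |u|
|∇ρ| ρ^((α-p)/p) and B = |∇u| ρ^(α/p), c² ∫ A^p ≤ c ∫ p |u|^(p-2) u ρ^(-c) |∇ρ|^(p-2) ∇ρ·∇u ≤ |c| p
∫ A^(p-1) B. Hölder's inequality gives |c| ‖A‖^p ≤ p ‖B‖ ‖A‖^(p-1) in L^p norms. As ‖A‖ is finite by
the local integrability of |∇ρ|^p / ρ^(p-α), it can be divided out.

The test function is not admissible as it stands, and two approximations repair this. The power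
s^(-c) is replaced by C^1 functions F_n = `truncPow c n`, whose derivative is supported in a compact
subset of (0, ∞), and ρ by smooth functions converging to it in W^{1,p}.
`HasSobolevGrad.nonneg_integral_comp` removes the second approximation for fixed n, through the
limit theorem `nonneg_integral_of_tendsto`. `hardy_of_nonneg_integral` then lets n tend to infinity.
The term with F_n needs only the bound F_n(s) ≤ s^(-c), uniform in n; the term with F_n' has a sign,
and Fatou's lemma suffices. -/

noncomputable section

namespace RiemannianHardy

/-! ### Calculus of the Riemannian gradient. -/

section Gradient

variable {N : ℕ} {M : Type*} [TopologicalSpace M] [ChartedSpace (EuclideanSpace ℝ (Fin N)) M]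
  [RiemannianBundle (fun x : M ↦ TangentSpace (𝓡 N) x)]

/-- The differential of a real function, as an element of the dual of the tangent space. -/
def differential (f : M → ℝ) (x : M) : StrongDual ℝ (TangentSpace (𝓡 N) x) :=
  mfderiv (𝓡 N) 𝓘(ℝ, ℝ) f x

theorem inner_grad (f : M → ℝ) (x : M) (v : TangentSpace (𝓡 N) x) :
    inner ℝ (grad (N := N) f x) v = differential f x v :=
  have := completeSpace_tangentSpace (N := N) x
  InnerProductSpace.toDual_symm_apply (x := v) (y := differential f x)

theorem inner_grad_of_hasMFDerivAt {f : M → ℝ} {x : M} {f' : TangentSpace (𝓡 N) x →L[ℝ] ℝ}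
    (h : HasMFDerivAt (𝓡 N) 𝓘(ℝ, ℝ) f x f') (v : TangentSpace (𝓡 N) x) :
    inner ℝ (grad (N := N) f x) v = f' v := by
  rw [inner_grad]
  exact DFunLike.congr_fun h.mfderiv v

theorem norm_grad (f : M → ℝ) (x : M) :
    ‖grad (N := N) f x‖ = ‖differential (N := N) f x‖ :=
  have := completeSpace_tangentSpace (N := N) x
  (InnerProductSpace.toDual ℝ (TangentSpace (𝓡 N) x)).symm.norm_map (differential f x)

theorem grad_eq_zero_of_notMem_tsupport {f : M → ℝ} {x : M} (hx : x ∉ tsupport f) :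
    grad (N := N) f x = 0 := by
  have h : f =ᶠ[𝓝 x] fun _ ↦ 0 := notMem_tsupport_iff_eventuallyEq.1 hx
  have h2 : HasMFDerivAt (𝓡 N) 𝓘(ℝ, ℝ) f x (0 : TangentSpace (𝓡 N) x →L[ℝ] ℝ) :=
    (hasMFDerivAt_const 0 x).congr_of_eventuallyEq h
  refine ext_inner_right ℝ fun v ↦ ?_
  rw [inner_grad_of_hasMFDerivAt h2, inner_zero_left]
  rfl

theorem grad_add {f g : M → ℝ} {x : M} (hf : MDifferentiableAt (𝓡 N) 𝓘(ℝ, ℝ) f x)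
    (hg : MDifferentiableAt (𝓡 N) 𝓘(ℝ, ℝ) g x) :
    grad (N := N) (f + g) x = grad f x + grad g x := by
  refine ext_inner_right ℝ fun v ↦ ?_
  rw [inner_add_left, inner_grad_of_hasMFDerivAt hf.hasMFDerivAt,
    inner_grad_of_hasMFDerivAt hg.hasMFDerivAt,
    inner_grad_of_hasMFDerivAt (hf.hasMFDerivAt.add hg.hasMFDerivAt)]
  rfl

theorem grad_mul {f g : M → ℝ} {x : M} (hf : MDifferentiableAt (𝓡 N) 𝓘(ℝ, ℝ) f x)
    (hg : MDifferentiableAt (𝓡 N) 𝓘(ℝ, ℝ) g x) :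
    grad (N := N) (f * g) x = f x • grad g x + g x • grad f x := by
  refine ext_inner_right ℝ fun v ↦ ?_
  rw [inner_add_left, real_inner_smul_left, real_inner_smul_left,
    inner_grad_of_hasMFDerivAt hf.hasMFDerivAt,
    inner_grad_of_hasMFDerivAt hg.hasMFDerivAt,
    inner_grad_of_hasMFDerivAt (hf.hasMFDerivAt.mul hg.hasMFDerivAt)]
  rfl

theorem grad_comp {f : M → ℝ} {h : ℝ → ℝ} {h' : ℝ} {x : M}
    (hf : MDifferentiableAt (𝓡 N) 𝓘(ℝ, ℝ) f x) (hh : HasDerivAt h h' (f x)) :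
    grad (N := N) (h ∘ f) x = h' • grad f x := by
  refine ext_inner_right ℝ fun v ↦ ?_
  rw [real_inner_smul_left, inner_grad_of_hasMFDerivAt hf.hasMFDerivAt,
    inner_grad_of_hasMFDerivAt (hh.hasFDerivAt.hasMFDerivAt.comp x hf.hasMFDerivAt)]
  exact mul_comm _ _

variable [IsManifold (𝓡 N) 1 M] [IsContinuousRiemannianBundle (EuclideanSpace ℝ (Fin N))
      (fun x : M ↦ TangentSpace (𝓡 N) x)]

/-- The norm of the gradient of a `C^1` function is continuous. -/
theorem continuousAt_norm_grad {f : M → ℝ} {x₀ : M}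
    (hf : ContMDiffAt (𝓡 N) 𝓘(ℝ, ℝ) 1 f x₀) :
    ContinuousAt (fun x ↦ ‖grad (N := N) f x‖) x₀ := by
  let F := EuclideanSpace ℝ (Fin N)
  let e := trivializationAt F (fun x : M ↦ TangentSpace (𝓡 N) x) x₀
  let D : (x : M) → TangentSpace (𝓡 N) x →L[ℝ] ℝ := fun x ↦ differential f x
  let L : M → F →L[ℝ] ℝ := fun x ↦ D x ∘L e.symmL ℝ x
  -- `A x` is the differential at `x` carried by the trivialization to the fixed space at `x₀`.
  -- There it varies continuously in norm, while the transport distorts norms by a factor tending to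
  -- 1 in both directions.
  let A : M → TangentSpace (𝓡 N) x₀ →L[ℝ] ℝ := fun x ↦
    L x ∘L e.continuousLinearMapAt ℝ x₀
  have hbase : ∀ᶠ x in 𝓝 x₀, x ∈ e.baseSet :=
    e.open_baseSet.mem_nhds (FiberBundle.mem_baseSet_trivializationAt' x₀)
  have hL : ContinuousAt L x₀ := by
    refine (hf.mfderiv_const (m := 0) le_rfl).continuousAt.congr (Eventually.of_forall fun x ↦ ?_)
    ext v
    change ((trivializationAt ℝ (TangentSpace 𝓘(ℝ, ℝ)) (f x₀)).continuousLinearMapAt ℝ (f x))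
      (D x (e.symmL ℝ x v)) = D x (e.symmL ℝ x v)
    rw [TangentBundle.continuousLinearMapAt_model_space (𝕜 := ℝ) (f x₀) (f x)]
    rfl
  have hT : ∀ᶠ x in 𝓝 x₀, D x = A x ∘L ((e.symmL ℝ x₀) ∘L (e.continuousLinearMapAt ℝ x)) := by
    filter_upwards [hbase] with x hx
    ext v
    have h0 : e.continuousLinearMapAt ℝ x₀ (e.symmL ℝ x₀ (e.continuousLinearMapAt ℝ x v)) =
        e.continuousLinearMapAt ℝ x v :=
      e.continuousLinearMapAt_symmL (FiberBundle.mem_baseSet_trivializationAt' x₀) _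
    have h1 : e.symmL ℝ x (e.continuousLinearMapAt ℝ x v) = v :=
      e.symmL_continuousLinearMapAt hx _
    change D x v = D x (e.symmL ℝ x (e.continuousLinearMapAt ℝ x₀ (e.symmL ℝ x₀
      (e.continuousLinearMapAt ℝ x v))))
    rw [h0, h1]
  have hA₀ : A x₀ = D x₀ := by
    ext v
    have h1 : e.symmL ℝ x₀ (e.continuousLinearMapAt ℝ x₀ v) = v :=
      e.symmL_continuousLinearMapAt (FiberBundle.mem_baseSet_trivializationAt' x₀) _
    change D x₀ (e.symmL ℝ x₀ (e.continuousLinearMapAt ℝ x₀ v)) = D x₀ v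
    rw [h1]
  have hle : ∀ r > 1, ∀ᶠ x in 𝓝 x₀, ‖D x‖ ≤ ‖A x‖ * r := fun r hr ↦ by
    filter_upwards [hT, eventually_norm_symmL_trivializationAt_self_comp_lt F
      (fun x : M ↦ TangentSpace (𝓡 N) x) x₀ hr] with x h1 h2
    rw [h1]
    exact (ContinuousLinearMap.opNorm_comp_le _ _).trans (by gcongr)
  have hge : ∀ r > 1, ∀ᶠ x in 𝓝 x₀, ‖A x‖ ≤ ‖D x‖ * r := fun r hr ↦ by
    filter_upwards [eventually_norm_symmL_trivializationAt_comp_self_lt F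
      (fun x : M ↦ TangentSpace (𝓡 N) x) x₀ hr] with x h2
    exact (ContinuousLinearMap.opNorm_comp_le (D x) ((e.symmL ℝ x) ∘L
      (e.continuousLinearMapAt ℝ x₀))).trans (by gcongr)
  have hAn : Tendsto (fun x ↦ ‖A x‖) (𝓝 x₀) (𝓝 ‖D x₀‖) := by
    rw [← hA₀]
    have h0 : Tendsto (fun x ↦ ‖L x - L x₀‖ * ‖e.continuousLinearMapAt ℝ x₀‖) (𝓝 x₀) (𝓝 0) := by
      simpa using (tendsto_iff_norm_sub_tendsto_zero.1 hL.tendsto).mul_const _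
    rw [tendsto_iff_norm_sub_tendsto_zero]
    refine squeeze_zero (fun _ ↦ norm_nonneg _) (fun x ↦ ?_) h0
    refine (abs_norm_sub_norm_le (A x) (A x₀)).trans ?_
    rw [show A x - A x₀ = (L x - L x₀) ∘L e.continuousLinearMapAt ℝ x₀ from rfl]
    exact (ContinuousLinearMap.opNorm_comp_le (L x - L x₀) (e.continuousLinearMapAt ℝ x₀))
  have hmul (b : ℝ) : Tendsto (fun r : ℝ ↦ b * r) (𝓝[>] 1) (𝓝 b) := by
    simpa using (tendsto_id.const_mul b : Tendsto _ (𝓝 (1 : ℝ)) _).mono_left nhdsWithin_le_nhds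
  simp only [ContinuousAt, norm_grad]
  refine tendsto_order.2 ⟨fun b hb ↦ ?_, fun b hb ↦ ?_⟩
  · obtain ⟨r, hr, hr1⟩ := (((hmul b).eventually (gt_mem_nhds hb)).and self_mem_nhdsWithin).exists
    filter_upwards [hAn.eventually (lt_mem_nhds hr), hge r hr1] with x h1 h2
    have hr0 : 0 < r := zero_lt_one.trans hr1
    exact lt_of_mul_lt_mul_right (h1.trans_le h2) hr0.le
  · obtain ⟨r, hr, hr1⟩ := (((hmul ‖D x₀‖).eventually (gt_mem_nhds hb)).and
      self_mem_nhdsWithin).exists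
    filter_upwards [(hAn.mul_const r).eventually (gt_mem_nhds hr), hle r hr1] with x h1 h2
    exact h2.trans_lt h1

theorem continuousOn_norm_grad {f : M → ℝ} {U : Set M} (hU : IsOpen U)
    (hf : ContMDiffOn (𝓡 N) 𝓘(ℝ, ℝ) 1 f U) :
    ContinuousOn (fun x ↦ ‖grad (N := N) f x‖) U := fun _ hx ↦
  (continuousAt_norm_grad (hf.contMDiffAt (hU.mem_nhds hx))).continuousWithinAt

/-- Polarization reduces this to the continuity of norms of gradients. -/
theorem continuousOn_inner_grad {f g : M → ℝ} {U : Set M} (hU : IsOpen U)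
    (hf : ContMDiffOn (𝓡 N) 𝓘(ℝ, ℝ) 1 f U) (hg : ContMDiffOn (𝓡 N) 𝓘(ℝ, ℝ) 1 g U) :
    ContinuousOn (fun x ↦ inner ℝ (grad (N := N) f x) (grad (N := N) g x)) U := by
  have h := ((((continuousOn_norm_grad hU (hf.add hg)).pow 2).sub
    ((continuousOn_norm_grad hU hf).pow 2)).sub ((continuousOn_norm_grad hU hg).pow 2)).div_const 2
  refine h.congr fun x hx ↦ ?_
  have hfx := (hf.contMDiffAt (hU.mem_nhds hx)).mdifferentiableAt one_ne_zero
  have hgx := (hg.contMDiffAt (hU.mem_nhds hx)).mdifferentiableAt one_ne_zero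
  simp only [Pi.sub_apply, Pi.pow_apply]
  rw [grad_add hfx hgx, norm_add_sq_real]
  ring

end Gradient

/-! ### C^1 truncations of the power s^(-c). -/

section Truncation

/-- A continuous cutoff of `t ↦ t ^ b` to a compact subset of `(0, ∞)`. -/
def cutoffPow (b : ℝ) (n : ℕ) (t : ℝ) : ℝ :=
  max 0 (min 1 (min ((n + 1) * t - 1) (n + 2 - t))) * max t (1 / (n + 1)) ^ b

/-- The maximum with 1/(n+1) keeps the base away from 0, where a negative power is discontinuous. -/
theorem continuous_cutoffPow (b : ℝ) (n : ℕ) : Continuous (cutoffPow b n) := by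
  unfold cutoffPow
  refine Continuous.mul (by fun_prop) (Continuous.rpow_const (by fun_prop) fun t ↦ Or.inl ?_)
  have : (0 : ℝ) < 1 / (n + 1) := by positivity
  exact (this.trans_le (le_max_right _ _)).ne'

theorem cutoffPow_nonneg (b : ℝ) (n : ℕ) (t : ℝ) : 0 ≤ cutoffPow b n t := by
  have : (0 : ℝ) ≤ 1 / (n + 1) := by positivity
  exact mul_nonneg (le_max_left _ _) (Real.rpow_nonneg (this.trans (le_max_right _ _)) _)

theorem cutoffPow_of_le {b : ℝ} {n : ℕ} {t : ℝ} (ht : t ≤ 1 / (n + 1)) : cutoffPow b n t = 0 := by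
  have h : (n + 1) * t - 1 ≤ 0 := by
    rw [le_div_iff₀ (by positivity)] at ht
    linarith
  rw [cutoffPow, max_eq_left, zero_mul]
  exact (min_le_right _ _).trans ((min_le_left _ _).trans h)

theorem cutoffPow_of_nonpos {b : ℝ} {n : ℕ} {t : ℝ} (ht : t ≤ 0) : cutoffPow b n t = 0 :=
  cutoffPow_of_le (ht.trans (by positivity))

theorem cutoffPow_of_ge {b : ℝ} {n : ℕ} {t : ℝ} (ht : n + 2 ≤ t) : cutoffPow b n t = 0 := by
  rw [cutoffPow, max_eq_left, zero_mul]
  exact (min_le_right _ _).trans ((min_le_right _ _).trans (by linarith))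

theorem cutoffPow_le {b : ℝ} {n : ℕ} {t : ℝ} (ht : 0 ≤ t) : cutoffPow b n t ≤ t ^ b := by
  rcases le_total t (1 / (n + 1)) with h | h
  · rw [cutoffPow_of_le h]
    exact Real.rpow_nonneg ht _
  · rw [cutoffPow, max_eq_left h]
    exact mul_le_of_le_one_left (Real.rpow_nonneg ht _) (max_le zero_le_one (min_le_left _ _))

theorem exists_cutoffPow_le (b : ℝ) (n : ℕ) : ∃ C, ∀ t, cutoffPow b n t ≤ C := by
  have hc : HasCompactSupport (cutoffPow b n) :=
    HasCompactSupport.intro (isCompact_Icc (a := (0 : ℝ)) (b := n + 2)) fun t ht ↦ by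
      rcases le_total t 0 with h | h
      · exact cutoffPow_of_nonpos h
      · exact cutoffPow_of_ge (le_of_not_ge fun h' ↦ ht ⟨h, h'⟩)
  obtain ⟨C, hC⟩ := hc.exists_bound_of_continuous (continuous_cutoffPow b n)
  exact ⟨C, fun t ↦ (le_abs_self _).trans (hC t)⟩

/-- The sequence is eventually constant, since the cutoff factor equals 1 on [2/(n+1), n+1]. -/
theorem tendsto_cutoffPow (b : ℝ) {t : ℝ} (ht : 0 < t) :
    Tendsto (fun n ↦ cutoffPow b n t) atTop (𝓝 (t ^ b)) := by
  refine tendsto_const_nhds.congr' ?_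
  filter_upwards [tendsto_natCast_atTop_atTop.eventually_ge_atTop (2 / t),
    tendsto_natCast_atTop_atTop.eventually_ge_atTop t] with n h1 h2
  rw [div_le_iff₀ ht] at h1
  have h3 : 1 / ((n : ℝ) + 1) ≤ t := by
    rw [div_le_iff₀ (by positivity)]
    linarith
  rw [cutoffPow, max_eq_left h3, min_eq_left, max_eq_right zero_le_one, one_mul]
  exact le_min (by linarith) (by linarith)

/-- Nonnegative functions increasing to `s ^ (-c)` on `(0, ∞)`, with derivative bounded and
supported in a compact subset of `(0, ∞)`. -/
def truncPow (c : ℝ) (n : ℕ) (s : ℝ) : ℝ :=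
  -c * ∫ t in (if 0 < c then (n + 2 : ℝ) else 0)..s, cutoffPow (-c - 1) n t

theorem hasDerivAt_truncPow (c : ℝ) (n : ℕ) (s : ℝ) :
    HasDerivAt (truncPow c n) (-c * cutoffPow (-c - 1) n s) s :=
  (((continuous_cutoffPow _ n).integral_hasStrictDerivAt _ s).hasDerivAt).const_mul _

/-- Needed on {ρ = 0}: when c < 0, neither u nor ∇ρ has to vanish there. -/
theorem truncPow_zero_of_neg {c : ℝ} (hc : c < 0) (n : ℕ) : truncPow c n 0 = 0 := by
  simp [truncPow, hc.not_gt]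

/-- The derivative has the sign of -c, and the base point lies where the cutoff has died out: at n+2
for c > 0, at 0 for c < 0. The function thus vanishes beyond the base point and grows away from it
on the other side. -/
theorem truncPow_nonneg (c : ℝ) (n : ℕ) (s : ℝ) : 0 ≤ truncPow c n s := by
  unfold truncPow
  split_ifs with hc
  · rw [neg_mul, ← mul_neg, ← intervalIntegral.integral_symm]
    refine mul_nonneg hc.le ?_
    rcases le_total s (n + 2) with h | h
    · exact intervalIntegral.integral_nonneg h fun t _ ↦ cutoffPow_nonneg _ _ _
    · rw [intervalIntegral.integral_congr (g := fun _ ↦ 0)]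
      · simp
      · intro t ht
        rw [uIcc_of_ge h] at ht
        exact cutoffPow_of_ge ht.1
  · refine mul_nonneg (by linarith) ?_
    rcases le_total 0 s with h | h
    · exact intervalIntegral.integral_nonneg h fun t _ ↦ cutoffPow_nonneg _ _ _
    · rw [intervalIntegral.integral_congr (g := fun _ ↦ 0)]
      · simp
      · intro t ht
        rw [uIcc_of_ge h] at ht
        exact cutoffPow_of_nonpos ht.2

/-- Integrate `cutoffPow_le` from the base point. For c < 0 the power t^(-c-1) is integrable at 0
and gives s^(-c); for c > 0 and s ≤ n+2 it gives s^(-c) - (n+2)^(-c). -/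
theorem truncPow_le (c : ℝ) (n : ℕ) {s : ℝ} (hs : 0 < s) : truncPow c n s ≤ s ^ (-c) := by
  rcases lt_trichotomy c 0 with hc | rfl | hc
  · have hI : IntervalIntegrable (fun t : ℝ ↦ t ^ (-c - 1)) volume 0 s :=
      intervalIntegral.intervalIntegrable_rpow' (by linarith)
    have h := intervalIntegral.integral_mono_on hs.le
      ((continuous_cutoffPow (-c - 1) n).intervalIntegrable 0 s) hI
      fun t ht ↦ cutoffPow_le ht.1
    rw [integral_rpow (Or.inl (by linarith))] at h
    simp only [sub_add_cancel] at h
    rw [Real.zero_rpow (by linarith), sub_zero, le_div_iff₀' (by linarith)] at h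
    simpa [truncPow, hc.not_gt] using h
  · simp [truncPow]
  · simp only [truncPow, if_pos hc]
    rw [neg_mul, ← mul_neg, ← intervalIntegral.integral_symm]
    rcases le_total s (n + 2) with h' | h'
    · have h0 : (0 : ℝ) ∉ uIcc s (n + 2) := by
        rw [uIcc_of_le h']
        exact fun h ↦ hs.not_ge h.1
      have h := intervalIntegral.integral_mono_on h'
        ((continuous_cutoffPow (-c - 1) n).intervalIntegrable s (n + 2))
        (intervalIntegral.intervalIntegrable_rpow (Or.inr h0) : IntervalIntegrable
          (fun t : ℝ ↦ t ^ (-c - 1)) volume _ _)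
        fun t ht ↦ cutoffPow_le (hs.le.trans ht.1)
      rw [integral_rpow (Or.inr ⟨by linarith, h0⟩)] at h
      simp only [sub_add_cancel] at h
      have h2 := mul_le_mul_of_nonneg_left h hc.le
      have h3 : 0 ≤ ((n : ℝ) + 2) ^ (-c) := by positivity
      have h4 : c * ((((n : ℝ) + 2) ^ (-c) - s ^ (-c)) / -c) = s ^ (-c) - (n + 2) ^ (-c) := by
        field_simp
        ring
      linarith
    · rw [intervalIntegral.integral_congr (g := fun _ ↦ 0)]
      · simpa using Real.rpow_nonneg hs.le _
      · intro t ht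
        rw [uIcc_of_ge h'] at ht
        exact cutoffPow_of_ge ht.1

end Truncation

/-! ### Hölder estimates and passage to the limit in the weak inequality. -/

section Limits

variable {X : Type*} [MeasurableSpace X] {ν : Measure X} {p : ℝ}

/-- Hölder's inequality with the exponents `p` and `p / (p - 1)`. -/
theorem lintegral_mul_rpow_le_eLpNorm (hp : 1 < p) {g t : X → ℝ} (hg : AEStronglyMeasurable g ν)
    (ht : AEStronglyMeasurable t ν) :
    ∫⁻ x, ‖t x‖ₑ * ‖g x‖ₑ ^ (p - 1) ∂ν ≤
      eLpNorm t (ENNReal.ofReal p) ν * eLpNorm g (ENNReal.ofReal p) ν ^ (p - 1) := by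
  have hp0 : 0 < p := zero_lt_one.trans hp
  have hpq := Real.HolderConjugate.conjExponent hp
  refine (ENNReal.lintegral_mul_rpow_le_lintegral_rpow_mul_lintegral_rpow hpq ht.enorm
    hg.enorm).trans_eq ?_
  have h0 : ENNReal.ofReal p ≠ 0 := by simpa using hp0
  rw [eLpNorm_eq_lintegral_rpow_enorm_toReal h0 ENNReal.ofReal_ne_top,
    eLpNorm_eq_lintegral_rpow_enorm_toReal h0 ENNReal.ofReal_ne_top,
    ENNReal.toReal_ofReal hp0.le, ← ENNReal.rpow_mul]
  congr 2
  rw [Real.conjExponent]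
  field_simp

/-- Serves twice: with g = |∇ρ| and t an approximation error, and with g = A and t = B in the Hardy
estimate. -/
theorem integrable_of_abs_le_rpow_mul (hp : 1 < p) {g t e : X → ℝ} {K : ℝ}
    (hg : MemLp g (ENNReal.ofReal p) ν) (ht : MemLp t (ENNReal.ofReal p) ν)
    (he : AEStronglyMeasurable e ν) (hle : ∀ᵐ x ∂ν, |e x| ≤ K * (|g x| ^ (p - 1) * |t x|)) :
    Integrable e ν ∧ ∫⁻ x, ‖e x‖ₑ ∂ν ≤ ENNReal.ofReal K *
      (eLpNorm t (ENNReal.ofReal p) ν * eLpNorm g (ENNReal.ofReal p) ν ^ (p - 1)) := by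
  have h : ∫⁻ x, ‖e x‖ₑ ∂ν ≤ ENNReal.ofReal K *
      (eLpNorm t (ENNReal.ofReal p) ν * eLpNorm g (ENNReal.ofReal p) ν ^ (p - 1)) := by
    refine le_trans ?_ (mul_le_mul_right (lintegral_mul_rpow_le_eLpNorm hp hg.1 ht.1) _)
    rw [← lintegral_const_mul' _ _ ENNReal.ofReal_ne_top]
    refine lintegral_mono_ae (hle.mono fun x hx ↦ ?_)
    rw [← ofReal_norm, ← ofReal_norm, ← ofReal_norm, ENNReal.ofReal_rpow_of_nonneg (norm_nonneg _)
      (by linarith), ← ENNReal.ofReal_mul (norm_nonneg _), ← ENNReal.ofReal_mul' (by positivity)]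
    refine ENNReal.ofReal_le_ofReal (hx.trans_eq ?_)
    simp only [Real.norm_eq_abs]
    ring
  refine ⟨⟨he, h.trans_lt ?_⟩, h⟩
  exact ENNReal.mul_lt_top ENNReal.ofReal_lt_top
    (ENNReal.mul_lt_top ht.2 (ENNReal.rpow_lt_top_of_nonneg (by linarith) hg.2.ne))

theorem tendsto_integral_of_abs_le_rpow_mul (hp : 1 < p) {g : X → ℝ} {t e : ℕ → X → ℝ} {K : ℝ}
    (hg : MemLp g (ENNReal.ofReal p) ν) (ht : ∀ n, MemLp (t n) (ENNReal.ofReal p) ν)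
    (ht0 : Tendsto (fun n ↦ eLpNorm (t n) (ENNReal.ofReal p) ν) atTop (𝓝 0))
    (he : ∀ n, AEStronglyMeasurable (e n) ν)
    (hle : ∀ n, ∀ᵐ x ∂ν, |e n x| ≤ K * (|g x| ^ (p - 1) * |t n x|)) :
    Tendsto (fun n ↦ ∫ x, e n x ∂ν) atTop (𝓝 0) := by
  have hI n := integrable_of_abs_le_rpow_mul hp hg (ht n) (he n) (hle n)
  have hgt : eLpNorm g (ENNReal.ofReal p) ν ^ (p - 1) ≠ ⊤ :=
    (ENNReal.rpow_lt_top_of_nonneg (by linarith) hg.2.ne).ne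
  have h0 : Tendsto (fun n ↦ ENNReal.ofReal K *
      (eLpNorm (t n) (ENNReal.ofReal p) ν * eLpNorm g (ENNReal.ofReal p) ν ^ (p - 1)))
      atTop (𝓝 0) := by
    have := ENNReal.Tendsto.const_mul (ENNReal.Tendsto.mul_const ht0 (Or.inr hgt))
      (Or.inr (ENNReal.ofReal_ne_top (r := K)))
    simpa using this
  have := tendsto_integral_of_L1' (f := fun _ : X ↦ (0 : ℝ)) (F := e) (l := atTop) (μ := ν)
    aestronglyMeasurable_const (Eventually.of_forall fun n ↦ (hI n).1) ?_
  · simpa using this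
  · refine tendsto_of_tendsto_of_tendsto_of_le_of_le tendsto_const_nhds h0 (fun _ ↦ zero_le)
      fun n ↦ ?_
    rw [eLpNorm_one_eq_lintegral_enorm]
    simpa using (hI n).2

/-- A sequence converging in `L^p` converges almost everywhere along a subsequence. -/
theorem exists_subseq_tendsto_ae (hp : 1 < p) {t : ℕ → X → ℝ}
    (ht : ∀ n, AEStronglyMeasurable (t n) ν)
    (ht0 : Tendsto (fun n ↦ eLpNorm (t n) (ENNReal.ofReal p) ν) atTop (𝓝 0)) :
    ∃ ns : ℕ → ℕ, StrictMono ns ∧ ∀ᵐ x ∂ν, Tendsto (fun i ↦ t (ns i) x) atTop (𝓝 0) :=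
  (tendstoInMeasure_of_tendsto_eLpNorm (g := fun _ ↦ 0) 
    (by rw [Ne, ENNReal.ofReal_eq_zero]; linarith) ht
    aestronglyMeasurable_const (by simpa [Pi.sub_def] using ht0)).exists_seq_tendsto_ae

/-- Passage to the limit in the weak inequality tested with `w F(r_n)`. -/
theorem nonneg_integral_of_tendsto (hp : 1 < p) {c K C L : ℝ} {g r a w : X → ℝ}
    {rn s b : ℕ → X → ℝ} {F F' : ℝ → ℝ}
    (hg : MemLp g (ENNReal.ofReal p) ν) (hg0 : ∀ x, 0 ≤ g x)
    (hr : AEStronglyMeasurable r ν)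
    (hrn : ∀ n, MemLp (fun x ↦ rn n x - r x) (ENNReal.ofReal p) ν)
    (hrn0 : Tendsto (fun n ↦ eLpNorm (fun x ↦ rn n x - r x) (ENNReal.ofReal p) ν) atTop (𝓝 0))
    (hs : ∀ n, MemLp (s n) (ENNReal.ofReal p) ν)
    (hs0 : Tendsto (fun n ↦ eLpNorm (s n) (ENNReal.ofReal p) ν) atTop (𝓝 0))
    (ha : AEStronglyMeasurable a ν) (haK : ∀ᵐ x ∂ν, |a x| ≤ K * g x ^ (p - 1))
    (hb : ∀ n, AEStronglyMeasurable (b n) ν)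
    (hbs : ∀ n, ∀ᵐ x ∂ν, |b n x - g x ^ p| ≤ g x ^ (p - 1) * |s n x|)
    (hw : AEStronglyMeasurable w ν) (hwC : ∀ᵐ x ∂ν, |w x| ≤ C)
    (hF : ∀ t, HasDerivAt F (F' t) t) (hF' : Continuous F') (hFL : ∀ t, |F' t| ≤ L)
    (haF : Integrable (fun x ↦ a x * F (r x)) ν)
    (h : ∀ n, 0 ≤ c * ∫ x, a x * F (rn n x) + w x * F' (rn n x) * b n x ∂ν) :
    0 ≤ c * ∫ x, a x * F (r x) + w x * F' (r x) * g x ^ p ∂ν := by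
  obtain ⟨ns, hns, hlim⟩ := exists_subseq_tendsto_ae hp (fun n ↦ (hrn n).1) hrn0
  have hL : 0 ≤ L := (abs_nonneg _).trans (hFL 0)
  have hLip (x y : ℝ) : |F y - F x| ≤ L * |y - x| :=
    convex_univ.norm_image_sub_le_of_norm_hasDerivWithin_le
      (fun t _ ↦ (hF t).hasDerivWithinAt) (fun t _ ↦ hFL t) (mem_univ x) (mem_univ y)
  have hFc : Continuous F := continuous_iff_continuousAt.2 fun t ↦ (hF t).continuousAt
  have hrnm n : AEStronglyMeasurable (rn n) ν := by
    simpa [Pi.add_def] using (hrn n).1.add hr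
  have hgp : Integrable (fun x ↦ g x ^ p) ν := by
    have := hg.integrable_norm_rpow (by rw [Ne, ENNReal.ofReal_eq_zero]; linarith)
      ENNReal.ofReal_ne_top
    simpa [ENNReal.toReal_ofReal (zero_le_one.trans hp.le), abs_of_nonneg (hg0 _)] using this
  have m1 n : AEStronglyMeasurable (fun x ↦ a x * (F (rn n x) - F (r x))) ν :=
    ha.mul ((hFc.comp_aestronglyMeasurable (hrnm n)).sub (hFc.comp_aestronglyMeasurable hr))
  have l1 n : ∀ᵐ x ∂ν, |a x * (F (rn n x) - F (r x))| ≤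
      (K * L) * (|g x| ^ (p - 1) * |rn n x - r x|) := by
    filter_upwards [haK] with x hx
    rw [abs_mul, abs_of_nonneg (hg0 x)]
    calc |a x| * |F (rn n x) - F (r x)| ≤ (K * g x ^ (p - 1)) * (L * |rn n x - r x|) :=
          mul_le_mul hx (hLip _ _) (abs_nonneg _) ((abs_nonneg _).trans hx)
      _ = _ := by ring
  have m2 n : AEStronglyMeasurable (fun x ↦ w x * F' (rn n x) * (b n x - g x ^ p)) ν :=
    (hw.mul (hF'.comp_aestronglyMeasurable (hrnm n))).mul ((hb n).sub hgp.1)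
  have l2 n : ∀ᵐ x ∂ν, |w x * F' (rn n x) * (b n x - g x ^ p)| ≤
      (C * L) * (|g x| ^ (p - 1) * |s n x|) := by
    filter_upwards [hwC, hbs n] with x h1 h2
    have hC : 0 ≤ C := (abs_nonneg _).trans h1
    rw [abs_mul, abs_mul, abs_of_nonneg (hg0 x)]
    have := hFL (rn n x)
    gcongr
  have m3 n : AEStronglyMeasurable (fun x ↦ w x * (F' (rn n x) - F' (r x)) * g x ^ p) ν :=
    (hw.mul ((hF'.comp_aestronglyMeasurable (hrnm n)).sub
      (hF'.comp_aestronglyMeasurable hr))).mul hgp.1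
  have l3 n : ∀ᵐ x ∂ν, ‖w x * (F' (rn n x) - F' (r x)) * g x ^ p‖ ≤ C * (L + L) * g x ^ p := by
    filter_upwards [hwC] with x h1
    have hC : 0 ≤ C := (abs_nonneg _).trans h1
    have h2 : |F' (rn n x) - F' (r x)| ≤ L + L :=
      (abs_sub _ _).trans (add_le_add (hFL _) (hFL _))
    have h3 : 0 ≤ g x ^ p := Real.rpow_nonneg (hg0 x) _
    rw [Real.norm_eq_abs, abs_mul, abs_mul, abs_of_nonneg h3]
    gcongr
  have i1 n := (integrable_of_abs_le_rpow_mul hp hg (hrn n) (m1 n) (l1 n)).1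
  have i2 n := (integrable_of_abs_le_rpow_mul hp hg (hs n) (m2 n) (l2 n)).1
  have i3 n : Integrable (fun x ↦ w x * (F' (rn n x) - F' (r x)) * g x ^ p) ν :=
    (hgp.const_mul (C * (L + L))).mono' (m3 n) (l3 n)
  have i4 : Integrable (fun x ↦ w x * F' (r x) * g x ^ p) ν := by
    refine (hgp.const_mul (C * L)).mono'
      ((hw.mul (hF'.comp_aestronglyMeasurable hr)).mul hgp.1) ?_
    filter_upwards [hwC] with x h1
    have hC : 0 ≤ C := (abs_nonneg _).trans h1
    have h2 := hFL (r x)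
    have h3 : 0 ≤ g x ^ p := Real.rpow_nonneg (hg0 x) _
    rw [Real.norm_eq_abs, abs_mul, abs_mul, abs_of_nonneg h3]
    gcongr
  have t1 := (tendsto_integral_of_abs_le_rpow_mul hp hg hrn hrn0 m1 l1).comp hns.tendsto_atTop
  have t2 := (tendsto_integral_of_abs_le_rpow_mul hp hg hs hs0 m2 l2).comp hns.tendsto_atTop
  -- F' is only continuous, so this error is not controlled by the L^p distance; dominated
  -- convergence along the a.e. convergent subsequence replaces it.
  have t3 : Tendsto (fun i ↦ ∫ x, w x * (F' (rn (ns i) x) - F' (r x)) * g x ^ p ∂ν) atTop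
      (𝓝 (∫ _, (0 : ℝ) ∂ν)) := by
    refine tendsto_integral_of_dominated_convergence _ (fun i ↦ m3 (ns i))
      (hgp.const_mul (C * (L + L))) (fun i ↦ l3 (ns i)) ?_
    filter_upwards [hlim] with x hx
    have h1 : Tendsto (fun i ↦ rn (ns i) x) atTop (𝓝 (r x)) := by
      simpa using hx.add_const (r x)
    have h2 := ((hF'.tendsto (r x)).comp h1).sub_const (F' (r x))
    simpa using (h2.const_mul (w x)).mul_const (g x ^ p)
  have key i : ∫ x, a x * F (rn i x) + w x * F' (rn i x) * b i x ∂ν =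
      (∫ x, a x * F (r x) + w x * F' (r x) * g x ^ p ∂ν) +
      ((∫ x, a x * (F (rn i x) - F (r x)) ∂ν + ∫ x, w x * F' (rn i x) * (b i x - g x ^ p) ∂ν) +
        ∫ x, w x * (F' (rn i x) - F' (r x)) * g x ^ p ∂ν) := by
    rw [← integral_add (i1 i) (i2 i), ← integral_add ?_ (i3 i), ← integral_add]
    · exact integral_congr_ae (Eventually.of_forall fun x ↦ by ring)
    · exact haF.add i4
    · exact ((i1 i).add (i2 i)).add (i3 i)
    · exact (i1 i).add (i2 i)
  have hT := (((t1.add t2).add t3).const_add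
    (∫ x, a x * F (r x) + w x * F' (r x) * g x ^ p ∂ν)).const_mul c
  simp only [integral_zero, add_zero] at hT
  refine ge_of_tendsto' hT fun i ↦ ?_
  have := h (ns i)
  rwa [key] at this

end Limits

/-! ### Test functions built from u and ρ. -/

section Test

/-- Valid at x = 0 whatever the value of 0^(p-2), because p - 1 > 0. Hence {∇ρ = 0} needs no
separate treatment, even for p < 2. -/
theorem rpow_sub_two_mul_self {x p : ℝ} (hx : 0 ≤ x) (hp : 1 < p) :
    x ^ (p - 2) * x = x ^ (p - 1) := by
  rcases hx.eq_or_lt with rfl | hx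
  · rw [mul_zero, Real.zero_rpow (by linarith)]
  · rw [← Real.rpow_add_one hx.ne']
    congr 1
    ring

theorem rpow_sub_one_mul_self {x p : ℝ} (hx : 0 ≤ x) (hp : 1 < p) :
    x ^ (p - 1) * x = x ^ p := by
  rcases hx.eq_or_lt with rfl | hx
  · rw [mul_zero, Real.zero_rpow (by linarith)]
  · rw [← Real.rpow_add_one hx.ne']
    congr 1
    ring

variable {N : ℕ} {M : Type*} [TopologicalSpace M] [ChartedSpace (EuclideanSpace ℝ (Fin N)) M]
  [RiemannianBundle (fun x : M ↦ TangentSpace (𝓡 N) x)] [MeasurableSpace M]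
  {p : ℝ} {U : Set M} {ρ : M → ℝ} {G : (x : M) → TangentSpace (𝓡 N) x}

theorem HasSobolevGrad.aestronglyMeasurable (h : HasSobolevGrad p U ρ G) :
    AEStronglyMeasurable ρ ((riemannianVolume N M).restrict U) := by
  obtain ⟨φ, -, h2, -, h4, -⟩ := h.exists_approx
  simpa [Pi.sub_def] using (h2 0).1.sub (h4 0).1

/-- Measurability of |G| is inherited from the smooth gradients, which converge to G a.e. along a
subsequence. -/
theorem HasSobolevGrad.memLp_norm (hp : 1 < p) (h : HasSobolevGrad p U ρ G) :
    MemLp (fun x ↦ ‖G x‖) (ENNReal.ofReal p) ((riemannianVolume N M).restrict U) := by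
  obtain ⟨φ, -, -, h3, -, h5, -, h7⟩ := h.exists_approx
  obtain ⟨ns, -, hlim⟩ := exists_subseq_tendsto_ae hp (fun n ↦ (h5 n).1) h7
  have hm : AEStronglyMeasurable (fun x ↦ ‖G x‖) ((riemannianVolume N M).restrict U) := by
    refine aestronglyMeasurable_of_tendsto_ae atTop (fun i ↦ (h3 (ns i)).1) ?_
    filter_upwards [hlim] with x hx
    rw [tendsto_iff_norm_sub_tendsto_zero]
    exact squeeze_zero (fun _ ↦ norm_nonneg _) (fun i ↦ abs_norm_sub_norm_le _ _) hx
  refine ((h3 0).add (h5 0)).mono hm (Eventually.of_forall fun x ↦ ?_)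
  have h1 : ‖G x‖ ≤ ‖grad (N := N) (φ 0) x‖ + ‖grad (N := N) (φ 0) x - G x‖ := by
    simpa using norm_sub_le (grad (N := N) (φ 0) x) (grad (N := N) (φ 0) x - G x)
  simpa using h1.trans (le_abs_self _)

variable [IsManifold (𝓡 N) 1 M] [IsContinuousRiemannianBundle (EuclideanSpace ℝ (Fin N))
      (fun x : M ↦ TangentSpace (𝓡 N) x)] [BorelSpace M]

theorem HasSobolevGrad.aestronglyMeasurable_inner (hp : 1 < p) (hU : IsOpen U)
    (h : HasSobolevGrad p U ρ G) {f : M → ℝ} (hf : ContMDiffOn (𝓡 N) 𝓘(ℝ, ℝ) 1 f U) :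
    AEStronglyMeasurable (fun x ↦ inner ℝ (G x) (grad (N := N) f x))
      ((riemannianVolume N M).restrict U) := by
  obtain ⟨φ, h1, -, -, -, h5, -, h7⟩ := h.exists_approx
  obtain ⟨ns, -, hlim⟩ := exists_subseq_tendsto_ae hp (fun n ↦ (h5 n).1) h7
  refine aestronglyMeasurable_of_tendsto_ae atTop (f := fun i x ↦
    inner ℝ (grad (N := N) (φ (ns i)) x) (grad (N := N) f x)) (fun i ↦
      (continuousOn_inner_grad hU ((h1 (ns i)).of_le (by simp)) hf).aestronglyMeasurable
        hU.measurableSet) ?_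
  filter_upwards [hlim] with x hx
  rw [tendsto_iff_norm_sub_tendsto_zero]
  refine squeeze_zero (fun _ ↦ norm_nonneg _) (fun i ↦ ?_)
    (by simpa using hx.mul_const ‖grad (N := N) f x‖)
  rw [← inner_sub_left]
  exact norm_inner_le_norm _ _

/-- The weak inequality may be tested with `|u|^p F(ρ)`. -/
theorem HasSobolevGrad.nonneg_integral_comp (hp : 1 < p) {Ω : Set M} (hΩ : IsOpen Ω)
    (hU : IsOpen U) (hUΩ : U ⊆ Ω) (h : HasSobolevGrad p U ρ G) {c : ℝ}
    (hΔ : WeakNegPLaplacianNonneg c p Ω G) {u : M → ℝ} (hu : ContMDiff (𝓡 N) 𝓘(ℝ, ℝ) 1 u)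
    (hu_supp : HasCompactSupport u) (huU : tsupport u ⊆ U) {F F' : ℝ → ℝ} {L : ℝ}
    (hF : ∀ t, HasDerivAt F (F' t) t) (hF' : Continuous F') (hFL : ∀ t, |F' t| ≤ L)
    (hF0 : ∀ t, 0 ≤ F t)
    (haF : Integrable (fun x ↦ ‖G x‖ ^ (p - 2) * inner ℝ (G x) (grad (N := N) u x) *
      (p * |u x| ^ (p - 2) * u x) * F (ρ x)) ((riemannianVolume N M).restrict U)) :
    0 ≤ c * ∫ x in U, ‖G x‖ ^ (p - 2) * inner ℝ (G x) (grad (N := N) u x) *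
      (p * |u x| ^ (p - 2) * u x) * F (ρ x) + |u x| ^ p * F' (ρ x) * ‖G x‖ ^ p
        ∂(riemannianVolume N M) := by
  have hg := h.memLp_norm hp
  have hin := h.aestronglyMeasurable_inner hp hU (f := u) hu.contMDiffOn
  obtain ⟨φ, h1, -, -, h4, h5, h6, h7⟩ := h.exists_approx
  have hp0 : 0 < p := zero_lt_one.trans hp
  have hd (t : ℝ) : HasDerivAt (fun t : ℝ ↦ |t| ^ p) (p * |t| ^ (p - 2) * t) t :=
    hasDerivAt_abs_rpow t hp
  have hdc : ContDiff ℝ 1 (fun t : ℝ ↦ |t| ^ p) := by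
    simpa using contDiff_norm_rpow (E := ℝ) hp
  -- For p < 2 the factor |t|^(p-2) is discontinuous at 0; the product is continuous as the
  -- derivative of the C^1 function |t|^p.
  have hd' : Continuous fun t : ℝ ↦ p * |t| ^ (p - 2) * t := by
    have := hdc.continuous_deriv le_rfl
    rwa [funext fun t ↦ (hd t).deriv] at this
  have hFc : ContDiff ℝ 1 F := by
    rw [contDiff_one_iff_deriv]
    refine ⟨fun t ↦ (hF t).differentiableAt, ?_⟩
    rwa [funext fun t ↦ (hF t).deriv]
  have hφ n : ContMDiffOn (𝓡 N) 𝓘(ℝ, ℝ) 1 (φ n) U := (h1 n).of_le (by simp)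
  have hgm : AEStronglyMeasurable (fun x ↦ ‖G x‖ ^ (p - 2))
      ((riemannianVolume N M).restrict U) :=
    (hg.1.aemeasurable.pow_const _).aestronglyMeasurable
  -- bounds on the support of `u`
  obtain ⟨C, hC⟩ := (hu_supp.comp_left (g := fun t : ℝ ↦ |t| ^ p)
    (by simp [hp0.ne'])).exists_bound_of_continuous (hdc.continuous.comp hu.continuous)
  obtain ⟨K, hK⟩ : ∃ K, ∀ x, |p * |u x| ^ (p - 2) * u x| * ‖grad (N := N) u x‖ ≤ K := by
    have hcont : Continuous fun x ↦ (p * |u x| ^ (p - 2) * u x) * ‖grad (N := N) u x‖ :=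
      (hd'.comp hu.continuous).mul (continuous_iff_continuousAt.2 fun x ↦
        continuousAt_norm_grad hu.contMDiffAt)
    obtain ⟨K, hK⟩ := HasCompactSupport.exists_bound_of_continuous
      ((hu_supp.comp_left (g := fun t : ℝ ↦ p * |t| ^ (p - 2) * t) (by simp)).mul_right) hcont
    refine ⟨K, fun x ↦ ?_⟩
    simpa [abs_mul] using hK x
  refine nonneg_integral_of_tendsto (K := K) (C := C) (L := L) hp hg (fun x ↦ norm_nonneg _)
    h.aestronglyMeasurable h4 h6 h5 h7
    (a := fun x ↦ ‖G x‖ ^ (p - 2) * inner ℝ (G x) (grad (N := N) u x) *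
      (p * |u x| ^ (p - 2) * u x))
    (w := fun x ↦ |u x| ^ p)
    (b := fun n x ↦ ‖G x‖ ^ (p - 2) * inner ℝ (G x) (grad (N := N) (φ n) x))
    ((hgm.mul hin).mul
      ((hd'.comp hu.continuous).continuousOn.aestronglyMeasurable hU.measurableSet))
    ?_ (fun n ↦ hgm.mul (h.aestronglyMeasurable_inner hp hU (hφ n))) ?_
    ((hdc.continuous.comp hu.continuous).continuousOn.aestronglyMeasurable hU.measurableSet)
    ?_ hF hF' hFL haF ?_
  · refine Eventually.of_forall fun x ↦ ?_
    calc |‖G x‖ ^ (p - 2) * inner ℝ (G x) (grad (N := N) u x) * (p * |u x| ^ (p - 2) * u x)|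
        = ‖G x‖ ^ (p - 2) * |inner ℝ (G x) (grad (N := N) u x)| *
            |p * |u x| ^ (p - 2) * u x| := by
          rw [abs_mul, abs_mul, abs_of_nonneg (Real.rpow_nonneg (norm_nonneg (G x)) _)]
      _ ≤ ‖G x‖ ^ (p - 2) * (‖G x‖ * ‖grad (N := N) u x‖) * |p * |u x| ^ (p - 2) * u x| := by
          gcongr
          exact abs_real_inner_le_norm _ _
      _ = ‖G x‖ ^ (p - 1) * (|p * |u x| ^ (p - 2) * u x| * ‖grad (N := N) u x‖) := by
          rw [← rpow_sub_two_mul_self (norm_nonneg (G x)) hp]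
          ring
      _ ≤ ‖G x‖ ^ (p - 1) * K := by
          gcongr
          exact hK x
      _ = _ := mul_comm _ _
  · refine fun n ↦ Eventually.of_forall fun x ↦ ?_
    have e1 : ‖G x‖ ^ (p - 2) * inner ℝ (G x) (grad (N := N) (φ n) x) - ‖G x‖ ^ p =
        ‖G x‖ ^ (p - 2) * inner ℝ (G x) (grad (N := N) (φ n) x - G x) := by
      rw [inner_sub_right, real_inner_self_eq_norm_sq,
        ← rpow_sub_one_mul_self (norm_nonneg (G x)) hp,
        ← rpow_sub_two_mul_self (norm_nonneg (G x)) hp]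
      ring
    rw [e1, abs_mul, abs_of_nonneg (Real.rpow_nonneg (norm_nonneg (G x)) _),
      ← rpow_sub_two_mul_self (norm_nonneg (G x)) hp, mul_assoc, abs_norm]
    gcongr
    exact abs_real_inner_le_norm _ _
  · exact Eventually.of_forall fun x ↦ hC x
  · intro n
    have hsub : tsupport (fun x ↦ |u x| ^ p * F (φ n x)) ⊆ tsupport u := by
      refine closure_mono fun x hx ↦ ?_
      contrapose! hx
      simp [Function.notMem_support.1 hx, hp0.ne']
    have hψ : ContMDiff (𝓡 N) 𝓘(ℝ, ℝ) 1 (fun x ↦ |u x| ^ p * F (φ n x)) := by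
      -- `φ n` is smooth only on `U`, but the factor |u|^p vanishes near every point outside
      -- `tsupport u`.
      refine contMDiff_of_tsupport fun x hx ↦ ?_
      have hxU : x ∈ U := huU (hsub hx)
      exact (hdc.contMDiff.contMDiffAt.comp x hu.contMDiffAt).mul
        (hFc.contMDiff.contMDiffAt.comp x ((hφ n).contMDiffAt (hU.mem_nhds hxU)))
    have key := hΔ _ hψ (hu_supp.of_isClosed_subset (isClosed_tsupport _) hsub)
      (hsub.trans (huU.trans hUΩ)) fun x ↦ mul_nonneg (by positivity) (hF0 _)
    rw [setIntegral_eq_of_subset_of_forall_sdiff_eq_zero hΩ.measurableSet hUΩ] at key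
    · refine key.trans_eq ?_
      congr 1
      refine setIntegral_congr_fun hU.measurableSet fun x hx ↦ ?_
      have d1 : MDifferentiableAt (𝓡 N) 𝓘(ℝ, ℝ) u x := hu.mdifferentiable one_ne_zero x
      have d2 : MDifferentiableAt (𝓡 N) 𝓘(ℝ, ℝ) (φ n) x :=
        ((hφ n).contMDiffAt (hU.mem_nhds hx)).mdifferentiableAt one_ne_zero
      have e1 : grad (N := N) (fun x ↦ |u x| ^ p * F (φ n x)) x =
          |u x| ^ p • F' (φ n x) • grad (φ n) x +
            F (φ n x) • (p * |u x| ^ (p - 2) * u x) • grad u x := by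
        rw [← grad_comp d1 (hd (u x)), ← grad_comp d2 (hF (φ n x))]
        exact grad_mul ((hdc.contMDiff.mdifferentiable one_ne_zero _).comp x d1)
          ((hFc.contMDiff.mdifferentiable one_ne_zero _).comp x d2)
      simp only [e1, inner_add_right, real_inner_smul_right]
      ring
    · intro x hx
      rw [grad_eq_zero_of_notMem_tsupport fun h ↦ hx.2 (huU (hsub h)), inner_zero_right, mul_zero]

end Test

/-! ### From the truncated weak inequalities to Hardy's inequality. -/

section Hardy

/-- The power `t ^ b` for `t > 0`, extended by zero. -/
def posPow (b t : ℝ) : ℝ := if 0 < t then t ^ b else 0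

theorem measurable_posPow (b : ℝ) : Measurable (posPow b) :=
  Measurable.ite measurableSet_Ioi (measurable_id.pow_const b) measurable_const

theorem posPow_of_pos {b t : ℝ} (ht : 0 < t) : posPow b t = t ^ b := if_pos ht

theorem posPow_of_nonpos {b t : ℝ} (ht : t ≤ 0) : posPow b t = 0 := if_neg ht.not_gt

theorem posPow_nonneg (b t : ℝ) : 0 ≤ posPow b t := by
  unfold posPow
  split_ifs with h
  · positivity
  · exact le_rfl

theorem lintegral_enorm_rpow_eq_eLpNorm {X : Type*} [MeasurableSpace X] {ν : Measure X} {p : ℝ}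
    (hp : 0 < p) (f : X → ℝ) :
    ∫⁻ x, ‖f x‖ₑ ^ p ∂ν = eLpNorm f (ENNReal.ofReal p) ν ^ p := by
  rw [eLpNorm_eq_lintegral_rpow_enorm_toReal (by simpa using hp) ENNReal.ofReal_ne_top,
    ENNReal.toReal_ofReal hp.le, ← ENNReal.rpow_mul, one_div_mul_cancel hp.ne', ENNReal.rpow_one]

/-- If `d x^p ≤ p y x^(p-1)` then `(d/p)^p x^p ≤ y^p`. -/
theorem div_rpow_mul_rpow_le {p d x y : ℝ} (hp : 1 < p) (hd : 0 ≤ d) (hx : 0 ≤ x) (hy : 0 ≤ y)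
    (h : d * x ^ p ≤ p * (y * x ^ (p - 1))) : (d / p) ^ p * x ^ p ≤ y ^ p := by
  have hp0 : 0 < p := zero_lt_one.trans hp
  rw [← Real.mul_rpow (by positivity) hx]
  refine Real.rpow_le_rpow (by positivity) ?_ hp0.le
  rcases hx.eq_or_lt with rfl | hx
  · simpa using hy
  · rw [← rpow_sub_one_mul_self hx.le hp] at h
    have h2 : 0 < x ^ (p - 1) := by positivity
    have h3 : d * x ≤ p * y := le_of_mul_le_mul_right (by linarith) h2
    rw [div_mul_eq_mul_div, div_le_iff₀ hp0]
    linarith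

/-- Applied to x = ‖A‖ and y = ‖B‖; the finiteness of x is what allows x^(p-1) to be cancelled. -/
theorem div_rpow_mul_rpow_le_ennreal {p d : ℝ} {x y : ℝ≥0∞} (hp : 1 < p) (hd : 0 ≤ d)
    (hx : x ≠ ⊤) (hy : y ≠ ⊤)
    (h : ENNReal.ofReal d * x ^ p ≤ ENNReal.ofReal p * (y * x ^ (p - 1))) :
    ENNReal.ofReal ((d / p) ^ p) * x ^ p ≤ y ^ p := by
  have hp0 : 0 < p := zero_lt_one.trans hp
  lift x to NNReal using hx
  lift y to NNReal using hy
  rw [← ENNReal.ofReal_coe_nnreal, ← ENNReal.ofReal_coe_nnreal,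
    ENNReal.ofReal_rpow_of_nonneg x.coe_nonneg hp0.le, ENNReal.ofReal_rpow_of_nonneg x.coe_nonneg (by linarith),
    ← ENNReal.ofReal_mul hd, ← ENNReal.ofReal_mul y.coe_nonneg, ← ENNReal.ofReal_mul hp0.le,
    ENNReal.ofReal_le_ofReal_iff (by positivity)] at h
  rw [← ENNReal.ofReal_coe_nnreal, ← ENNReal.ofReal_coe_nnreal,
    ENNReal.ofReal_rpow_of_nonneg x.coe_nonneg hp0.le, ENNReal.ofReal_rpow_of_nonneg y.coe_nonneg hp0.le,
    ← ENNReal.ofReal_mul (by positivity)]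
  exact ENNReal.ofReal_le_ofReal (div_rpow_mul_rpow_le hp hd x.coe_nonneg y.coe_nonneg h)

variable {X : Type*} [MeasurableSpace X] {ν : Measure X} {p α : ℝ}

/-- The Hardy inequality follows from the weak inequalities tested with `|v|^p F(ρ)`, where `F`
runs through the truncations of the power `ρ^(-(p - 1 - α))`. -/
theorem hardy_of_nonneg_integral (hp : 1 < p) (hα : p - 1 - α ≠ 0) {ρ g v D a : X → ℝ}
    (hρ : AEStronglyMeasurable ρ ν) (hρ0 : ∀ᵐ x ∂ν, 0 ≤ ρ x)
    (hg : AEStronglyMeasurable g ν) (hg0 : ∀ x, 0 ≤ g x)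
    (hv : AEStronglyMeasurable v ν)
    (hD : AEStronglyMeasurable D ν) (hD0 : ∀ x, 0 ≤ D x)
    (hm : AEMeasurable (fun x ↦ ‖g x‖ₑ ^ p / ENNReal.ofReal (ρ x) ^ (p - α)) ν)
    (hfin : ∫⁻ x, ‖v x‖ₑ ^ p * (‖g x‖ₑ ^ p / ENNReal.ofReal (ρ x) ^ (p - α)) ∂ν < ⊤)
    (ha : AEStronglyMeasurable a ν)
    (hale : ∀ x, |a x| ≤ p * (|v x| ^ (p - 1) * g x ^ (p - 1) * D x))
    (htest : ∀ n, Integrable (fun x ↦ a x * truncPow (p - 1 - α) n (ρ x)) ν →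
      0 ≤ (p - 1 - α) * ∫ x, a x * truncPow (p - 1 - α) n (ρ x) +
        |v x| ^ p * (-(p - 1 - α) * cutoffPow (-(p - 1 - α) - 1) n (ρ x)) * g x ^ p ∂ν) :
    ENNReal.ofReal ((|p - 1 - α| / p) ^ p) * ∫⁻ x, ENNReal.ofReal (ρ x) ^ α *
        (‖v x‖ₑ ^ p / ENNReal.ofReal (ρ x) ^ p) * ‖g x‖ₑ ^ p ∂ν ≤
      ∫⁻ x, ENNReal.ofReal (ρ x) ^ α * ‖D x‖ₑ ^ p ∂ν := by
  have hp0 : 0 < p := zero_lt_one.trans hp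
  rcases eq_or_ne (∫⁻ x, ENNReal.ofReal (ρ x) ^ α * ‖D x‖ₑ ^ p ∂ν) ⊤ with hB | hB
  · rw [hB]
    exact le_top
  set c := p - 1 - α with hc
  -- On {ρ > 0}, A^p and B^p are the integrands of the two sides; both functions are set to 0
  -- elsewhere.
  let A : X → ℝ := fun x ↦ |v x| * g x * posPow ((α - p) / p) (ρ x)
  let B : X → ℝ := fun x ↦ D x * posPow (α / p) (ρ x)
  have hA0 x : 0 ≤ A x := mul_nonneg (mul_nonneg (abs_nonneg _) (hg0 x)) (posPow_nonneg _ _)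
  have hB0 x : 0 ≤ B x := mul_nonneg (hD0 x) (posPow_nonneg _ _)
  have hposm (b : ℝ) : AEStronglyMeasurable (fun x ↦ posPow b (ρ x)) ν :=
    ((measurable_posPow b).comp_aemeasurable hρ.aemeasurable).aestronglyMeasurable
  have hAm : AEStronglyMeasurable A ν := (hv.norm.mul hg).mul (hposm _)
  have hBm : AEStronglyMeasurable B ν := hD.mul (hposm _)
  have hAp {x : X} (hx : 0 < ρ x) : A x ^ p = |v x| ^ p * g x ^ p * ρ x ^ (α - p) := by
    simp only [A, posPow_of_pos hx]
    rw [Real.mul_rpow (mul_nonneg (abs_nonneg _) (hg0 x)) (by positivity),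
      Real.mul_rpow (abs_nonneg _) (hg0 x), ← Real.rpow_mul hx.le, div_mul_cancel₀ _ hp0.ne']
  have hAz {x : X} (hx : ρ x ≤ 0) : A x = 0 := by simp [A, posPow_of_nonpos hx]
  have hBz {x : X} (hx : ρ x ≤ 0) : B x = 0 := by simp [B, posPow_of_nonpos hx]
  have hAe {x : X} (hx : 0 < ρ x) : ‖A x‖ₑ ^ p = ‖v x‖ₑ ^ p * ‖g x‖ₑ ^ p *
      ENNReal.ofReal (ρ x) ^ (α - p) := by
    simp only [A, posPow_of_pos hx, enorm_mul]
    rw [← Real.norm_eq_abs, enorm_norm, Real.enorm_of_nonneg (Real.rpow_nonneg hx.le _),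
      ← ENNReal.ofReal_rpow_of_pos hx, ENNReal.mul_rpow_of_nonneg _ _ hp0.le,
      ENNReal.mul_rpow_of_nonneg _ _ hp0.le, ← ENNReal.rpow_mul, div_mul_cancel₀ _ hp0.ne']
  have hBe {x : X} (hx : 0 < ρ x) : ‖B x‖ₑ ^ p = ENNReal.ofReal (ρ x) ^ α * ‖D x‖ₑ ^ p := by
    simp only [B, posPow_of_pos hx, enorm_mul]
    rw [Real.enorm_of_nonneg (Real.rpow_nonneg hx.le _),
      ← ENNReal.ofReal_rpow_of_pos hx, ENNReal.mul_rpow_of_nonneg _ _ hp0.le,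
      ← ENNReal.rpow_mul, div_mul_cancel₀ _ hp0.ne', mul_comm]
  have hAB {x : X} (hx : 0 < ρ x) : A x ^ (p - 1) * B x =
      |v x| ^ (p - 1) * g x ^ (p - 1) * D x * ρ x ^ (-c) := by
    simp only [A, B, posPow_of_pos hx]
    have e : -c = (α - p) / p * (p - 1) + α / p := by
      rw [hc]
      field_simp
      ring
    rw [Real.mul_rpow (mul_nonneg (abs_nonneg _) (hg0 x)) (Real.rpow_nonneg hx.le _),
      Real.mul_rpow (abs_nonneg _) (hg0 x), ← Real.rpow_mul hx.le, e, Real.rpow_add hx]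
    ring
  -- behaviour on the zero set of `ρ`
  have hzero : ∀ᵐ x ∂ν, ρ x ≤ 0 → c < 0 ∨ v x = 0 ∨ g x = 0 := by
    have hvm : AEMeasurable (fun x ↦ ‖v x‖ₑ ^ p) ν := hv.enorm.pow_const p
    filter_upwards [ae_lt_top' (hvm.mul hm) hfin.ne] with x hx hρx
    by_contra! hcon
    obtain ⟨hc0, hvx, hgx⟩ := hcon
    -- If c ≥ 0 then p - α ≥ 1, so the quotient at ρ = 0 has denominator 0 and the integrand would
    -- be infinite.
    refine hx.ne ?_
    have h1 : ‖g x‖ₑ ^ p ≠ 0 := by simp [hgx, hp0]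
    have h2 : ‖v x‖ₑ ^ p ≠ 0 := by simp [hvx, hp0]
    rw [Pi.mul_apply, ENNReal.ofReal_of_nonpos hρx, ENNReal.zero_rpow_of_pos (by linarith),
      ENNReal.div_zero h1, ENNReal.mul_top h2]
  have hAlt : ∫⁻ x, ‖A x‖ₑ ^ p ∂ν < ⊤ := by
    refine (lintegral_mono fun x ↦ ?_).trans_lt hfin
    rcases lt_or_ge 0 (ρ x) with hx | hx
    · rw [hAe hx, ← neg_sub p α, ENNReal.rpow_neg, div_eq_mul_inv, mul_assoc]
    · simp [hAz hx, hp0]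
  have hBle : ∫⁻ x, ‖B x‖ₑ ^ p ∂ν ≤ ∫⁻ x, ENNReal.ofReal (ρ x) ^ α * ‖D x‖ₑ ^ p ∂ν := by
    refine lintegral_mono fun x ↦ ?_
    rcases lt_or_ge 0 (ρ x) with hx | hx
    · exact (hBe hx).le
    · simp [hBz hx, hp0]
  have hAL : MemLp A (ENNReal.ofReal p) ν := by
    refine ⟨hAm, ?_⟩
    rw [lintegral_enorm_rpow_eq_eLpNorm hp0] at hAlt
    exact (ENNReal.rpow_lt_top_iff_of_pos hp0).1 hAlt
  have hBL : MemLp B (ENNReal.ofReal p) ν := by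
    refine ⟨hBm, ?_⟩
    have := hBle.trans_lt hB.lt_top
    rw [lintegral_enorm_rpow_eq_eLpNorm hp0] at this
    exact (ENNReal.rpow_lt_top_iff_of_pos hp0).1 this
  have hTm n : AEStronglyMeasurable (fun x ↦ a x * truncPow c n (ρ x)) ν :=
    ha.mul ((continuous_iff_continuousAt.2 fun t ↦
      (hasDerivAt_truncPow c n t).continuousAt).comp_aestronglyMeasurable hρ)
  have hTle n : ∀ᵐ x ∂ν, |a x * truncPow c n (ρ x)| ≤ p * (|A x| ^ (p - 1) * |B x|) := by
    filter_upwards [hρ0, hzero] with x h0 hz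
    rw [abs_mul, abs_of_nonneg (truncPow_nonneg c n (ρ x)), abs_of_nonneg (hA0 x),
      abs_of_nonneg (hB0 x)]
    rcases h0.eq_or_lt with h0 | h0
    · have hprod : |a x| * truncPow c n (ρ x) = 0 := by
        rcases hz h0.ge with hc0 | hvx | hgx
        · rw [← h0, truncPow_zero_of_neg hc0, mul_zero]
        · have := hale x
          rw [hvx, abs_zero, Real.zero_rpow (by linarith)] at this
          rw [le_antisymm (this.trans_eq (by ring)) (abs_nonneg _), zero_mul]
        · have := hale x
          rw [hgx, Real.zero_rpow (by linarith)] at this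
          rw [le_antisymm (this.trans_eq (by ring)) (abs_nonneg _), zero_mul]
      rw [hprod]
      exact mul_nonneg hp0.le (mul_nonneg (Real.rpow_nonneg (hA0 x) _) (hB0 x))
    · rw [hAB h0, ← mul_assoc]
      exact mul_le_mul (hale x) (truncPow_le c n h0) (truncPow_nonneg _ _ _)
        ((abs_nonneg _).trans (hale x))
  have hI n := integrable_of_abs_le_rpow_mul hp hAL hBL (hTm n) (hTle n)
  have hq0 n x : 0 ≤ |v x| ^ p * cutoffPow (-c - 1) n (ρ x) * g x ^ p :=
    mul_nonneg (mul_nonneg (by positivity) (cutoffPow_nonneg _ _ _)) (Real.rpow_nonneg (hg0 x) _)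
  have hqm n : AEStronglyMeasurable
      (fun x ↦ |v x| ^ p * cutoffPow (-c - 1) n (ρ x) * g x ^ p) ν :=
    (((hv.norm.aemeasurable.pow_const p).aestronglyMeasurable).mul
      ((continuous_cutoffPow _ n).comp_aestronglyMeasurable hρ)).mul
      (hg.aemeasurable.pow_const p).aestronglyMeasurable
  have hcα : -c - 1 = α - p := by rw [hc]; ring
  have hqI n : Integrable (fun x ↦ |v x| ^ p * cutoffPow (-c - 1) n (ρ x) * g x ^ p) ν := by
    have h1 := hAL.integrable_norm_rpow (by simpa using hp0) ENNReal.ofReal_ne_top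
    rw [ENNReal.toReal_ofReal hp0.le] at h1
    refine h1.mono' (hqm n) (Eventually.of_forall fun x ↦ ?_)
    rw [Real.norm_of_nonneg (hq0 n x), Real.norm_of_nonneg (hA0 x)]
    rcases lt_or_ge 0 (ρ x) with hx | hx
    · rw [hAp hx, ← hcα, mul_right_comm]
      have := cutoffPow_le (b := -c - 1) (n := n) hx.le
      have := hg0 x
      gcongr
    · rw [cutoffPow_of_nonpos hx, mul_zero, zero_mul]
      exact Real.rpow_nonneg (hA0 x) _
  have hstep n : ENNReal.ofReal |c| *
      ∫⁻ x, ENNReal.ofReal (|v x| ^ p * cutoffPow (-c - 1) n (ρ x) * g x ^ p) ∂ν ≤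
      ENNReal.ofReal p * (eLpNorm B (ENNReal.ofReal p) ν *
        eLpNorm A (ENNReal.ofReal p) ν ^ (p - 1)) := by
    have h1 := htest n (hI n).1
    have e : ∫ x, a x * truncPow c n (ρ x) +
        |v x| ^ p * (-c * cutoffPow (-c - 1) n (ρ x)) * g x ^ p ∂ν =
        ∫ x, a x * truncPow c n (ρ x) ∂ν +
          -c * ∫ x, |v x| ^ p * cutoffPow (-c - 1) n (ρ x) * g x ^ p ∂ν := by
      rw [← integral_const_mul, ← integral_add (hI n).1 ((hqI n).const_mul _)]
      exact integral_congr_ae (Eventually.of_forall fun x ↦ by ring)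
    rw [e] at h1
    set I₁ := ∫ x, a x * truncPow c n (ρ x) ∂ν with hI₁
    set I₂ := ∫ x, |v x| ^ p * cutoffPow (-c - 1) n (ρ x) * g x ^ p ∂ν with hI₂
    have hc0 : 0 < |c| := abs_pos.2 hα
    -- `h1` says c (I₁ - c I₂) ≥ 0, hence c² I₂ ≤ |c| |I₁| whatever the sign of c.
    have h2 : |c| * I₂ ≤ |I₁| := by
      refine le_of_mul_le_mul_left ?_ hc0
      calc |c| * (|c| * I₂) = c * c * I₂ := by rw [← mul_assoc, abs_mul_abs_self]
        _ ≤ c * I₁ := by linarith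
        _ ≤ |c| * |I₁| := by rw [← abs_mul]; exact le_abs_self _
    rw [← ofReal_integral_eq_lintegral_ofReal (hqI n) (Eventually.of_forall (hq0 n)),
      ← ENNReal.ofReal_mul hc0.le]
    refine (ENNReal.ofReal_le_ofReal h2).trans ?_
    rw [← Real.norm_eq_abs, ofReal_norm]
    exact (enorm_integral_le_lintegral_enorm _).trans (hI n).2
  have hfatou : ∫⁻ x, ‖A x‖ₑ ^ p ∂ν ≤ liminf (fun n ↦
      ∫⁻ x, ENNReal.ofReal (|v x| ^ p * cutoffPow (-c - 1) n (ρ x) * g x ^ p) ∂ν) atTop := by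
    refine le_trans (lintegral_mono fun x ↦ ?_)
      (lintegral_liminf_le' fun n ↦ (hqm n).aemeasurable.ennreal_ofReal)
    rcases lt_or_ge 0 (ρ x) with hx | hx
    · have ht := ENNReal.tendsto_ofReal
        (((tendsto_cutoffPow (-c - 1) hx).const_mul (|v x| ^ p)).mul_const (g x ^ p))
      rw [ht.liminf_eq, Real.enorm_of_nonneg (hA0 x),
        ENNReal.ofReal_rpow_of_nonneg (hA0 x) hp0.le, hAp hx, hcα, mul_right_comm]
    · simp [hAz hx, hp0]
  have hfinal : ENNReal.ofReal |c| * ∫⁻ x, ‖A x‖ₑ ^ p ∂ν ≤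
      ENNReal.ofReal p * (eLpNorm B (ENNReal.ofReal p) ν *
        eLpNorm A (ENNReal.ofReal p) ν ^ (p - 1)) := by
    refine ENNReal.mul_le_of_le_div' (hfatou.trans (liminf_le_of_le (by isBoundedDefault)
      fun b hb ↦ ?_))
    obtain ⟨n, hn⟩ := hb.exists
    refine hn.trans ?_
    rw [ENNReal.le_div_iff_mul_le (Or.inl (by simpa using hα)) (Or.inl ENNReal.ofReal_ne_top),
      mul_comm]
    exact hstep n
  rw [lintegral_enorm_rpow_eq_eLpNorm hp0] at hfinal
  have hend := div_rpow_mul_rpow_le_ennreal hp (abs_nonneg c) hAL.2.ne hBL.2.ne hfinal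
  rw [← lintegral_enorm_rpow_eq_eLpNorm hp0, ← lintegral_enorm_rpow_eq_eLpNorm hp0] at hend
  refine le_trans (mul_le_mul_right (lintegral_mono_ae ?_) _) (hend.trans hBle)
  filter_upwards [hzero] with x hz
  rcases lt_or_ge 0 (ρ x) with hx | hx
  · have h0 : ENNReal.ofReal (ρ x) ≠ 0 := by simpa using hx
    rw [hAe hx, ENNReal.rpow_sub _ _ h0 ENNReal.ofReal_ne_top, div_eq_mul_inv, div_eq_mul_inv]
    exact le_of_eq (by ring)
  · have h0 : ENNReal.ofReal (ρ x) ^ α * (‖v x‖ₑ ^ p / ENNReal.ofReal (ρ x) ^ p) * ‖g x‖ₑ ^ p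
        = 0 := by
      -- If c < 0 then α > p - 1 > 0, so 0^α = 0 annihilates the quotient even where it is infinite.
      rcases hz hx with hc0 | hvx | hgx
      · rw [ENNReal.ofReal_of_nonpos hx, ENNReal.zero_rpow_of_pos (by linarith), zero_mul, zero_mul]
      · simp [hvx, hp0]
      · simp [hgx, hp0]
    rw [h0]
    exact zero_le

end Hardy

end RiemannianHardy

end

/-! ### Localization to a neighbourhood of the support of u. -/

/-- The powers of `ρ` and the quotients are taken in `[0, ∞]`, so `ρ ^ α = ∞` where `ρ = 0`
and `α < 0`, and `0 / 0 = 0`. -/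
theorem mainTheorem3 {N : ℕ} {M : Type*} [EMetricSpace M] [CompleteSpace M]
    [SecondCountableTopology M] [MeasurableSpace M] [BorelSpace M]
    [ChartedSpace (EuclideanSpace ℝ (Fin N)) M] [IsManifold (𝓡 N) ∞ M]
    [RiemannianBundle (fun x : M ↦ TangentSpace (𝓡 N) x)]
    [IsContMDiffRiemannianBundle (𝓡 N) ∞ (EuclideanSpace ℝ (Fin N))
      (fun x : M ↦ TangentSpace (𝓡 N) x)]
    [IsRiemannianManifold (𝓡 N) M]
    (Ω : Set M) (hΩ : IsOpen Ω) (p : ℝ) (hp : 1 < p) (α : ℝ)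
    (ρ : M → ℝ) (gradρ : (x : M) → TangentSpace (𝓡 N) x)
    (hρ : RiemannianHardy.HasLocSobolevGrad p Ω ρ gradρ)
    (hρ_nonneg : ∀ᵐ x ∂(RiemannianHardy.riemannianVolume N M).restrict Ω, 0 ≤ ρ x)
    (hΔ : RiemannianHardy.WeakNegPLaplacianNonneg (p - 1 - α) p Ω gradρ)
    (hρ_grad : RiemannianHardy.LocL1 N Ω
      (fun x ↦ ‖gradρ x‖ₑ ^ p / ENNReal.ofReal (ρ x) ^ (p - α)))
    (hρ_pow : RiemannianHardy.LocL1 N Ω (fun x ↦ ENNReal.ofReal (ρ x) ^ α))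
    (u : M → ℝ) (hu : ContMDiff (𝓡 N) 𝓘(ℝ, ℝ) ∞ u) (hu_supp : HasCompactSupport u)
    (huΩ : tsupport u ⊆ Ω) :
    ENNReal.ofReal ((|p - 1 - α| / p) ^ p) *
        ∫⁻ x in Ω, ENNReal.ofReal (ρ x) ^ α * (‖u x‖ₑ ^ p / ENNReal.ofReal (ρ x) ^ p) *
          ‖gradρ x‖ₑ ^ p ∂(RiemannianHardy.riemannianVolume N M)
      ≤ ∫⁻ x in Ω, ENNReal.ofReal (ρ x) ^ α * ‖RiemannianHardy.grad (N := N) u x‖ₑ ^ p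
          ∂(RiemannianHardy.riemannianVolume N M) := by
  have hp0 : 0 < p := zero_lt_one.trans hp
  rcases eq_or_ne (p - 1 - α) 0 with hc | hc
  · simp [hc, hp0.ne']
  have : IsContinuousRiemannianBundle (EuclideanSpace ℝ (Fin N))
      (fun x : M ↦ TangentSpace (𝓡 N) x) := by
    obtain ⟨g, hg, hgi⟩ := IsContMDiffRiemannianBundle.exists_contMDiff (IB := 𝓡 N) (n := ∞)
      (F := EuclideanSpace ℝ (Fin N)) (E := fun x : M ↦ TangentSpace (𝓡 N) x)
    exact ⟨g, hg.continuous, hgi⟩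
  have : LocallyCompactSpace M := ChartedSpace.locallyCompactSpace (EuclideanSpace ℝ (Fin N)) M
  -- Only on such a relatively compact `U` does ρ have global W^{1,p} approximations; the left
  -- integrand vanishes off `U`, so nothing is lost.
  obtain ⟨U, hU, huU, hUΩ', hUc⟩ := exists_open_between_and_isCompact_closure hu_supp hΩ huΩ
  have hUΩ : U ⊆ Ω := subset_closure.trans hUΩ'
  have hS := hρ U hU hUc hUΩ'
  have hu1 : ContMDiff (𝓡 N) 𝓘(ℝ, ℝ) 1 u := hu.of_le (by simp)
  have hg := hS.memLp_norm hp
  have hin := hS.aestronglyMeasurable_inner hp hU (f := u) hu1.contMDiffOn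
  obtain ⟨hm, hlt⟩ := hρ_grad (closure U) hUc hUΩ'
  obtain ⟨C, hC⟩ := hu_supp.exists_bound_of_continuous hu.continuous
  have hum : AEStronglyMeasurable u ((RiemannianHardy.riemannianVolume N M).restrict U) :=
    hu.continuous.continuousOn.aestronglyMeasurable hU.measurableSet
  have key := RiemannianHardy.hardy_of_nonneg_integral hp hc (g := fun x ↦ ‖gradρ x‖) (v := u)
    (D := fun x ↦ ‖RiemannianHardy.grad (N := N) u x‖)
    (a := fun x ↦ ‖gradρ x‖ ^ (p - 2) * inner ℝ (gradρ x) (RiemannianHardy.grad (N := N) u x) *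
      (p * |u x| ^ (p - 2) * u x)) hS.aestronglyMeasurable
    (ae_mono (Measure.restrict_mono_set _ hUΩ) hρ_nonneg) hg.1 (fun _ ↦ norm_nonneg _) hum
    ((RiemannianHardy.continuousOn_norm_grad hU hu1.contMDiffOn).aestronglyMeasurable
      hU.measurableSet) (fun _ ↦ norm_nonneg _)
    (by simpa only [enorm_norm] using hm.mono_measure (Measure.restrict_mono_set _ subset_closure))
    ?_ ?_ ?_ ?_
  · simp only [enorm_norm] at key
    have hzero : ∀ x ∉ U, ENNReal.ofReal (ρ x) ^ α * (‖u x‖ₑ ^ p / ENNReal.ofReal (ρ x) ^ p) *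
        ‖gradρ x‖ₑ ^ p = 0 := fun x hx ↦ by
      have hux : u x = 0 := image_eq_zero_of_notMem_tsupport fun h ↦ hx (huU h)
      simp [hux, hp0]
    refine le_trans ?_ (key.trans (lintegral_mono_set hUΩ))
    rw [← lintegral_indicator hΩ.measurableSet, ← lintegral_indicator hU.measurableSet]
    refine mul_le_mul_right (lintegral_mono fun x ↦ ?_) _
    by_cases hx : x ∈ U
    · simp [hx, hUΩ hx]
    · simp only [indicator, hx, hzero x hx, ite_self, le_refl]
  · simp only [enorm_norm]
    refine lt_of_le_of_lt (lintegral_mono fun x ↦ mul_le_mul_left (b := _)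
      (c := ENNReal.ofReal C ^ p) ?_ _) ?_
    · refine ENNReal.rpow_le_rpow ?_ hp0.le
      rw [← ofReal_norm]
      exact ENNReal.ofReal_le_ofReal (hC x)
    · rw [lintegral_const_mul' _ _ (by finiteness)]
      exact ENNReal.mul_lt_top (by finiteness) ((lintegral_mono_set subset_closure).trans_lt hlt)
  · exact ((hg.1.aemeasurable.pow_const _).aestronglyMeasurable.mul hin).mul
      (((hum.norm.aemeasurable.pow_const _).const_mul p).aestronglyMeasurable.mul hum)
  · intro x
    calc |‖gradρ x‖ ^ (p - 2) * inner ℝ (gradρ x) (RiemannianHardy.grad (N := N) u x) *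
          (p * |u x| ^ (p - 2) * u x)|
        = ‖gradρ x‖ ^ (p - 2) * |inner ℝ (gradρ x) (RiemannianHardy.grad (N := N) u x)| *
            (p * (|u x| ^ (p - 2) * |u x|)) := by
          rw [abs_mul, abs_mul, abs_mul, abs_mul, abs_of_pos hp0,
            abs_of_nonneg (Real.rpow_nonneg (norm_nonneg (gradρ x)) _),
            abs_of_nonneg (Real.rpow_nonneg (abs_nonneg (u x)) _), mul_assoc p]
      _ ≤ ‖gradρ x‖ ^ (p - 2) * (‖gradρ x‖ * ‖RiemannianHardy.grad (N := N) u x‖) *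
            (p * (|u x| ^ (p - 2) * |u x|)) := by
          gcongr
          exact abs_real_inner_le_norm _ _
      _ = _ := by
          rw [RiemannianHardy.rpow_sub_two_mul_self (abs_nonneg _) hp,
            ← RiemannianHardy.rpow_sub_two_mul_self (norm_nonneg (gradρ x)) hp]
          ring
  · intro n hn
    obtain ⟨L, hL⟩ := RiemannianHardy.exists_cutoffPow_le (-(p - 1 - α) - 1) n
    exact hS.nonneg_integral_comp hp hΩ hU hUΩ hΔ hu1 hu_supp huU
      (RiemannianHardy.hasDerivAt_truncPow _ n)
      ((RiemannianHardy.continuous_cutoffPow _ n).const_mul _) (L := |-(p - 1 - α)| * L)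
      (fun t ↦ by
        rw [abs_mul, abs_of_nonneg (RiemannianHardy.cutoffPow_nonneg _ _ _)]
        gcongr
        exact hL t) (RiemannianHardy.truncPow_nonneg _ n) hn
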